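/- Let $k,l\ge 1$ be integers, $\mu>0$, and $\lambda_1,\dots,\lambda_l>0$; put $\lambda=\lambda_1+\dots+\lambda_l$ and $c_m=\lambda_m/\lambda$ for $1\le m\le l$. Let $\{\mathcal Q(t)\}_{t\ge 0}$, $\mathcal Q(t)=(\mathcal N(t),\mathcal S(t))$, be the Erlang queue with multiple arrivals, i.e. the single-server queue, empty at time $0$, in which customers arrive according to the generalized counting process (GCP) with rates $\lambda_1,\dots,\lambda_l$ and each service consists of $k$ independent exponential phases of mean $1/(k\mu)$, passed in the order $k,k-1,\dots,1$; here $\mathcal N(t)$ is the number of customers in the system and $\mathcal S(t)$ the phase of the customer in service ($\mathcal S(t)=0$ if $\mathcal N(t)=0$). Precisely, $\mathcal Q$ is a time-homogeneous Markov process on $\{(0,0)\}\cup\{(n,s): n\ge 1,\ 1\le s\le k\}$ with $\mathcal Q(0)=(0,0)$ almost surely such that, as $h\downarrow 0$, * for $1\le m\le l$, the transitions $(0,0)\to(m,k)$ and $(n,s)\to(n+m,s)$, $n\ge1$, during $(t,t+h]$ have conditional probability $\lambda c_m h+o(h)$ (arrival of $m$ customers); * the transitions $(n,s)\to(n,s-1)$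 for $s\ge 2$, $(n,1)\to(n-1,k)$ for $n\ge 2$, and $(1,1)\to(0,0)$ have conditional probability $k\mu h+o(h)$ (end of a phase); * the process stays at $(0,0)$ with conditional probability $1-\lambda h+o(h)$ and at $(n,s)$, $n\ge 1$, with conditional probability $1-(\lambda+k\mu)h+o(h)$; * every other transition has conditional probability $o(h)$. Let $p_0(t)=\Pr(\mathcal Q(t)=(0,0)\mid \mathcal Q(0)=(0,0))$, $p_{n,s}(t)=\Pr(\mathcal Q(t)=(n,s)\mid\mathcal Q(0)=(0,0))$ for $n\ge 1$, $1\le s\le k$, and $p_{0,s}(t)=0$ for $1\le s\le k$. Then these functions are differentiable on $[0,\infty)$ (from the right at $t=0$), and for all $t\ge 0$ \begin{align*} \frac{d}{dt}p_0(t)&=-\lambda p_0(t)+k\mu\,p_{1,1}(t),\\ \frac{d}{dt}p_{1,s}(t)&=-(\lambda+k\mu)p_{1,s}(t)+k\mu\,p_{1,s+1}(t),\quad 1\le s\le k-1,\\ \frac{d}{dt}p_{1,k}(t)&=-(\lambda+k\mu)p_{1,k}(t)+k\mu\,p_{2,1}(t)+\lambda c_1p_0(t),\\ \frac{d}{dt}p_{n,s}(t)&=-(\lambda+k\mu)p_{n,s}(t)+k\mu\,p_{n,s+1}(t)+\lambda\sum_{m=1}^{\min\{n,l\}}c_m\,p_{n-m,s}(t),\quad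 1\le s\le k-1,\ n\ge 2,\\ \frac{d}{dt}p_{n,k}(t)&=-(\lambda+k\mu)p_{n,k}(t)+k\mu\,p_{n+1,1}(t)+\lambda\sum_{m=1}^{n-1}c_m\,p_{n-m,k}(t)+\lambda c_n\,p_0(t),\quad 2\le n\le l,\\ \frac{d}{dt}p_{n,k}(t)&=-(\lambda+k\mu)p_{n,k}(t)+k\mu\,p_{n+1,1}(t)+\lambda\sum_{m=1}^{l}c_m\,p_{n-m,k}(t),\quad n>l, \end{align*} with initial conditions $p_0(0)=1$ and $p_{n,s}(0)=0$ for $n\ge 1$, $1\le s\le k$. -/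

import Mathlib

open Filter Topology Asymptotics MeasureTheory ProbabilityTheory

namespace ErlangQueue

/-- The state space `H ∪ {(0,0)}`: `(0,0)` is the empty system, and `(n,s)` with `n ≥ 1`,
`1 ≤ s ≤ k` means that `n` customers are present and the one in service is in phase `s`. -/
def stateSpace (k : ℕ) : Set (ℕ × ℕ) :=
  {x | x = (0, 0) ∨ (1 ≤ x.1 ∧ 1 ≤ x.2 ∧ x.2 ≤ k)}

/-- The total arrival rate `lam 1 + ... + lam l`. -/
noncomputable def totalRate (l : ℕ) (lam : ℕ → ℝ) : ℝ := ∑ j ∈ Finset.Icc 1 l, lam j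

/-- The probability `c m = lam m / (lam 1 + ... + lam l)` that an arriving group has size `m`. -/
noncomputable def groupProb (l : ℕ) (lam : ℕ → ℝ) (m : ℕ) : ℝ := lam m / totalRate l lam

/-- The state after `m` customers arrive. If the system was empty, the service of one of them
starts at once, in phase `k`. -/
def afterArrival (k m : ℕ) (x : ℕ × ℕ) : ℕ × ℕ :=
  if x = (0, 0) then (m, k) else (x.1 + m, x.2)

/-- The state after the current service phase is completed in a busy system. Phases are passed in
the order `k, k - 1, ..., 1`; at the end of phase `1` the customer leaves, and the next customer,
if there is one, starts in phase `k`. -/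
def afterPhase (k : ℕ) (x : ℕ × ℕ) : ℕ × ℕ :=
  if 2 ≤ x.2 then (x.1, x.2 - 1) else if 2 ≤ x.1 then (x.1 - 1, k) else (0, 0)

section Queue

variable {Ω : Type*} [MeasurableSpace Ω]

/-- The conditional probability `Pr(Q(t + h) = y | Q(t) = x)`. -/
noncomputable def transProb (P : Measure Ω) (Q : ℝ → Ω → ℕ × ℕ) (t h : ℝ) (x y : ℕ × ℕ) : ℝ :=
  (cond P {ω | Q t ω = x}).real {ω | Q (t + h) ω = y}

/-- The state-phase probability `Pr(Q(t) = (n,s) | Q(0) = (0,0))`. -/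
noncomputable def prob (P : Measure Ω) (Q : ℝ → Ω → ℕ × ℕ) (n s : ℕ) (t : ℝ) : ℝ :=
  (cond P {ω | Q 0 ω = (0, 0)}).real {ω | Q t ω = (n, s)}

/-- The sigma-algebra generated by `Q u`, `0 ≤ u ≤ t`. -/
abbrev history (Q : ℝ → Ω → ℕ × ℕ) (t : ℝ) : MeasurableSpace Ω :=
  ⨆ u ∈ Set.Icc (0 : ℝ) t, MeasurableSpace.comap (Q u) inferInstance

/-- `Q t = (N t, S t)`, `t ≥ 0`, is the Erlang queue with multiple arrivals: the time-homogeneous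
Markov process, empty at time `0`, in which groups of `m` customers arrive at rate
`lam m` (`1 ≤ m ≤ l`) and, independently, the service phase in progress ends at rate `k * mu`.
Only the times `t ≥ 0` matter. -/
structure IsErlangQueue (P : Measure Ω) (Q : ℝ → Ω → ℕ × ℕ)
    (k l : ℕ) (mu : ℝ) (lam : ℕ → ℝ) : Prop where
  measurable : ∀ t, 0 ≤ t → Measurable (Q t)
  mem_stateSpace : ∀ t, 0 ≤ t → ∀ ω, Q t ω ∈ stateSpace k
  start : ∀ᵐ ω ∂P, Q 0 ω = (0, 0)
  /-- Markov property: given the present state, the future is independent of the history. -/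
  markov : ∀ t h : ℝ, 0 ≤ t → 0 ≤ h → ∀ x y : ℕ × ℕ, ∀ F : Set Ω,
    MeasurableSet[history Q t] F → P (F ∩ {ω | Q t ω = x}) ≠ 0 →
    (cond P (F ∩ {ω | Q t ω = x})).real {ω | Q (t + h) ω = y} = transProb P Q t h x y
  homogeneous : ∀ t t' h : ℝ, 0 ≤ t → 0 ≤ t' → 0 ≤ h → ∀ x y : ℕ × ℕ,
    P {ω | Q t ω = x} ≠ 0 → P {ω | Q t' ω = x} ≠ 0 →
    transProb P Q t h x y = transProb P Q t' h x y
  /-- A group of `m` customers arrives, from the empty or from a busy state. -/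
  arrival : ∀ t, 0 ≤ t → ∀ x, P {ω | Q t ω = x} ≠ 0 → ∀ m ∈ Finset.Icc 1 l,
    (fun h : ℝ => transProb P Q t h x (afterArrival k m x)
      - totalRate l lam * groupProb l lam m * h) =o[𝓝[>] 0] fun h => h
  /-- A service phase ends. -/
  phase : ∀ t, 0 ≤ t → ∀ x, x ≠ (0, 0) → P {ω | Q t ω = x} ≠ 0 →
    (fun h : ℝ => transProb P Q t h x (afterPhase k x) - k * mu * h) =o[𝓝[>] 0] fun h => h
  /-- Nothing happens in the empty system: no arrival. -/
  stay_empty : ∀ t, 0 ≤ t → P {ω | Q t ω = (0, 0)} ≠ 0 →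
    (fun h : ℝ => transProb P Q t h (0, 0) (0, 0) - (1 - totalRate l lam * h))
      =o[𝓝[>] 0] fun h => h
  /-- Nothing happens in a busy system: neither an arrival (probability `1 - λ h + o(h)`) nor the
  end of a phase (probability `1 - k μ h + o(h)`), the two being independent. -/
  stay_busy : ∀ t, 0 ≤ t → ∀ x, x ≠ (0, 0) → P {ω | Q t ω = x} ≠ 0 →
    (fun h : ℝ => transProb P Q t h x x - (1 - totalRate l lam * h) * (1 - k * mu * h))
      =o[𝓝[>] 0] fun h => h
  /-- All other transitions have probability `o(h)`. -/
  other : ∀ t, 0 ≤ t → ∀ x y, P {ω | Q t ω = x} ≠ 0 → y ≠ x →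
    (∀ m ∈ Finset.Icc 1 l, y ≠ afterArrival k m x) → (x ≠ (0, 0) → y ≠ afterPhase k x) →
    (fun h : ℝ => transProb P Q t h x y) =o[𝓝[>] 0] fun h => h

end Queue

end ErlangQueue

/-!
The equations are Kolmogorov's forward equations of a Markov chain with bounded exit rates. The
hypotheses give the behaviour of the transition probabilities `T_h(x, y)` as `h → 0` only for each
pair of states separately, so the point is to obtain a bound that is uniform in the starting state.

By the Markov property and homogeneity, `h ↦ T_h(x, x)` is supermultiplicative, and its right
derivative at `0` is minus the exit rate of `x`. Bernoulli's inequality for `T_{h/n}(x, x) ^ n`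
then gives `1 - T_h(x, x) ≤ q h` with `q = Λ + k μ`, for all `h ≥ 0` and all `x`
(`IsErlangQueue.one_sub_transProb_self_le`). This has two consequences.

* The probability of each set of states is Lipschitz in time
  (`IsErlangQueue.continuousOn_measureReal`).
* By the law of total probability,
  `(P(Q (t + h) = y) - P(Q t = y)) / h = E[(T_h(Q t, y) - 1_{Q t = y}) / h]`, where the integrand
  is bounded by `q` and converges to the entry `(Q t, y)` of the generator. Dominated convergence
  gives the right derivative of `P(Q t = y)` (`IsErlangQueue.hasDerivWithinAt_Ioi`).

The right derivative is a finite combination of probabilities of sets of states, hence continuous,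
and a continuous function with a continuous right derivative is differentiable
(`IsErlangQueue.forward_equation`). It remains to list the states from which a given state is
reached by one arrival or by the end of one phase.
-/

namespace ErlangQueue

/-! ### Preliminaries from probability and calculus -/

/-- Law of total probability, for conditioning on the value of a discrete random variable. -/
theorem integral_cond_fiber {Ω α : Type*} [MeasurableSpace Ω] [MeasurableSpace α] [Countable α]
    [MeasurableSingletonClass α] (P : Measure Ω) [IsProbabilityMeasure P] {X : Ω → α}
    (hX : Measurable X) (B : Set Ω) :
    ∫ ω, (cond P {ω' | X ω' = X ω}).real B ∂P = P.real B := by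
  have hfib : ∀ x, MeasurableSet {ω | X ω = x} := fun x => hX (measurableSet_singleton x)
  have := Measure.isProbabilityMeasure_map (μ := P) hX.aemeasurable
  have hbdd : ∀ x, ‖(cond P {ω | X ω = x}).real B‖ ≤ 1 := fun x => by
    rw [Real.norm_of_nonneg measureReal_nonneg]
    exact measureReal_le_one
  have hint : Integrable (fun x => (cond P {ω | X ω = x}).real B) (P.map X) :=
    .of_bound (measurable_of_countable _).aestronglyMeasurable 1 (.of_forall hbdd)
  have hmap := integral_map hX.aemeasurable
    (f := fun x => (cond P {ω | X ω = x}).real B) hint.aestronglyMeasurable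
  rw [← hmap, integral_countable hint]
  -- Both sides are sums over the values of `X`; the right one is the total mass of the law of `X`
  -- under `P.restrict B`.
  have h1 : ∫ _, (1 : ℝ) ∂((P.restrict B).map X) = P.real B := by
    rw [integral_map hX.aemeasurable aestronglyMeasurable_const]
    simp
  rw [← h1, integral_countable (integrable_const _)]
  refine tsum_congr fun x => ?_
  rw [map_measureReal_apply hX (measurableSet_singleton x),
    map_measureReal_apply hX (measurableSet_singleton x),
    measureReal_restrict_apply (hX (measurableSet_singleton x)), smul_eq_mul, smul_eq_mul, mul_one,
    mul_comm]
  simp only [measureReal_def]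
  rw [← ENNReal.toReal_mul]
  exact congrArg _ (cond_mul_eq_inter (hfib x) B P)

theorem cond_real_mul {Ω : Type*} [MeasurableSpace Ω] (P : Measure Ω) [IsFiniteMeasure P]
    {A : Set Ω} (hA : MeasurableSet A) (B : Set Ω) :
    (cond P A).real B * P.real A = P.real (A ∩ B) := by
  simp only [measureReal_def]
  rw [← ENNReal.toReal_mul, cond_mul_eq_inter hA B P]

theorem cond_real_congr {Ω : Type*} [MeasurableSpace Ω] (P : Measure Ω)
    {A B C : Set Ω} (hA : MeasurableSet A) (h : A ∩ B = A ∩ C) :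
    (cond P A).real B = (cond P A).real C := by
  simp only [measureReal_def]
  rw [← cond_inter_self hA B, h, cond_inter_self hA]

/-- A discrete random variable almost surely takes a value that has positive probability. -/
theorem ae_fiber_ne_zero {Ω α : Type*} [MeasurableSpace Ω] [Countable α] (P : Measure Ω)
    (X : Ω → α) : ∀ᵐ ω ∂P, P {ω' | X ω' = X ω} ≠ 0 := by
  have h : ∀ᵐ ω ∂P, ∀ x, P {ω' | X ω' = x} = 0 → X ω ≠ x := by
    rw [ae_all_iff]
    intro x
    by_cases hx : P {ω' | X ω' = x} = 0
    · filter_upwards [measure_eq_zero_iff_ae_notMem.mp hx] with ω hω _ h using hω h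
    · exact .of_forall fun _ h => absurd h hx
  filter_upwards [h] with ω hω h0 using hω _ h0 rfl

/-- A continuous function whose right derivative is continuous is differentiable. -/
theorem hasDerivWithinAt_of_right {f g : ℝ → ℝ} (hf : ContinuousOn f (Set.Ici 0))
    (hg : ContinuousOn g (Set.Ici 0))
    (hfg : ∀ t, 0 ≤ t → HasDerivWithinAt f (g t) (Set.Ioi t) t) {t : ℝ} (ht : 0 ≤ t) :
    HasDerivWithinAt f (g t) (Set.Ici 0) t := by
  -- `u ↦ g (max u 0)` extends `g` to a continuous function on the whole line.
  have hmax : Continuous fun u : ℝ => g (max u 0) :=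
    hg.comp_continuous (by fun_prop) fun u => le_max_right u 0
  have hint : ∀ u ∈ Set.Ici (0 : ℝ), f u = f 0 + ∫ v in (0 : ℝ)..u, g (max v 0) := by
    intro u hu
    rw [intervalIntegral.integral_eq_sub_of_hasDeriv_right_of_le hu
      (hf.mono Set.Icc_subset_Ici_self) _ (hmax.intervalIntegrable _ _)]
    · ring
    · intro v hv
      rw [max_eq_left hv.1.le]
      exact hfg v hv.1.le
  have h := (hmax.integral_hasStrictDerivAt 0 t).hasDerivAt.hasDerivWithinAt (s := Set.Ici 0)
  rw [max_eq_left ht] at h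
  exact (h.const_add (f 0)).congr hint (hint t ht)

/-- If `f` is supermultiplicative with `f 0 = 1` and right derivative `-q` at `0`, then
`1 - f h ≤ q h` for all `h ≥ 0`: apply Bernoulli's inequality to `f (h / n) ^ n ≤ f h` and let `n`
tend to infinity. -/
theorem one_sub_le_mul_of_supermul {f : ℝ → ℝ} {q : ℝ} (h0 : ∀ h, 0 ≤ h → 0 ≤ f h)
    (hzero : f 0 = 1)
    (hmul : ∀ s h, 0 ≤ s → 0 ≤ h → f s * f h ≤ f (s + h))
    (hlim : Tendsto (fun h => (f h - 1) / h) (𝓝[>] 0) (𝓝 (-q))) {h : ℝ} (hh : 0 ≤ h) :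
    1 - f h ≤ q * h := by
  rcases hh.eq_or_lt with rfl | hh
  · simp [hzero]
  have hpow : ∀ (n : ℕ) (u : ℝ), 0 ≤ u → f u ^ n ≤ f (n * u) := by
    intro n u hu
    induction n with
    | zero => simp [hzero]
    | succ n ih =>
      calc f u ^ (n + 1) = f u ^ n * f u := pow_succ _ _
        _ ≤ f (n * u) * f u := by gcongr; exact h0 u hu
        _ ≤ f (n * u + u) := hmul _ _ (by positivity) hu
        _ = f ((n + 1 : ℕ) * u) := by push_cast; ring_nf
  have hseq : Tendsto (fun n : ℕ => h / ((n : ℝ) + 1)) atTop (𝓝[>] 0) := by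
    refine tendsto_nhdsWithin_iff.mpr ⟨?_, .of_forall fun n => Set.mem_Ioi.mpr (by positivity)⟩
    simpa [div_eq_mul_inv] using
      (tendsto_one_div_add_atTop_nhds_zero_nat (𝕜 := ℝ)).const_mul h
  have hlim' := (hlim.comp hseq).mul_const h
  have : -q * h ≤ f h - 1 := by
    refine le_of_tendsto hlim' (.of_forall fun n => ?_)
    have hn : (0 : ℝ) < n + 1 := by positivity
    have hb := one_add_mul_sub_le_pow (a := f (h / ((n : ℝ) + 1)))
      (by linarith [h0 (h / ((n : ℝ) + 1)) (by positivity)]) (n + 1)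
    have hp := hpow (n + 1) (h / ((n : ℝ) + 1)) (by positivity)
    have he : ((n + 1 : ℕ) : ℝ) * (h / ((n : ℝ) + 1)) = h := by push_cast; field_simp
    rw [he] at hp
    have h2 : (f (h / ((n : ℝ) + 1)) - 1) / (h / ((n : ℝ) + 1)) * h
        = ((n + 1 : ℕ) : ℝ) * (f (h / ((n : ℝ) + 1)) - 1) := by push_cast; field_simp
    simp only [Function.comp_apply]
    rw [h2]
    linarith
  linarith

/-! ### Transition rates -/

/-- The rate at which the state `x` is left, once it is occupied. -/
noncomputable def exitRate (k l : ℕ) (mu : ℝ) (lam : ℕ → ℝ) (x : ℕ × ℕ) : ℝ :=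
  totalRate l lam + if x = (0, 0) then 0 else k * mu

/-- The entry `(x, y)` of the generator of the queue: each event leading from `x` to `y`
contributes its rate, and on the diagonal the exit rate is subtracted. -/
noncomputable def generator (k l : ℕ) (mu : ℝ) (lam : ℕ → ℝ) (x y : ℕ × ℕ) : ℝ :=
  (∑ m ∈ Finset.Icc 1 l, if afterArrival k m x = y then lam m else 0)
    + (if x ≠ (0, 0) ∧ afterPhase k x = y then k * mu else 0)
    - if x = y then exitRate k l mu lam y else 0

theorem afterArrival_injective {k m m' : ℕ} {x : ℕ × ℕ}
    (h : afterArrival k m x = afterArrival k m' x) : m = m' := by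
  obtain ⟨n, s⟩ := x
  simp only [afterArrival] at h
  split_ifs at h <;> simp_all [Prod.ext_iff]

theorem fst_afterPhase_le {k : ℕ} (x : ℕ × ℕ) : (afterPhase k x).1 ≤ x.1 := by
  simp only [afterPhase]
  split_ifs <;> simp

theorem lt_fst_afterArrival {k m : ℕ} (hm : 1 ≤ m) (x : ℕ × ℕ) :
    x.1 < (afterArrival k m x).1 := by
  obtain ⟨n, s⟩ := x
  simp only [afterArrival]
  split_ifs with h <;> simp_all [Prod.ext_iff] <;> omega

theorem afterArrival_ne_self {k m : ℕ} (hm : 1 ≤ m) (x : ℕ × ℕ) : afterArrival k m x ≠ x :=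
  fun h => (lt_fst_afterArrival hm x).ne (congrArg Prod.fst h).symm

theorem afterPhase_ne_self {k : ℕ} {x : ℕ × ℕ} (hx : x ∈ stateSpace k) (h0 : x ≠ (0, 0)) :
    afterPhase k x ≠ x := by
  obtain ⟨n, s⟩ := x
  simp only [stateSpace, Set.mem_ofPred_eq, afterPhase, ne_eq, Prod.mk.injEq] at *
  split_ifs <;> simp_all [Prod.ext_iff] <;> omega

/-- No event leads from a state to itself, so the diagonal of the generator consists of the
exit rates. -/
theorem generator_self {k l : ℕ} {mu : ℝ} {lam : ℕ → ℝ} {x : ℕ × ℕ} (hx : x ∈ stateSpace k) :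
    generator k l mu lam x x = -exitRate k l mu lam x := by
  have harr : ∑ m ∈ Finset.Icc 1 l, (if afterArrival k m x = x then lam m else 0) = 0 :=
    Finset.sum_eq_zero fun m hm => if_neg (afterArrival_ne_self (Finset.mem_Icc.mp hm).1 x)
  have hph : ¬ (x ≠ (0, 0) ∧ afterPhase k x = x) := fun h => afterPhase_ne_self hx h.1 h.2
  rw [generator, harr, if_neg hph, if_pos rfl]
  ring

theorem totalRate_mul_groupProb {l : ℕ} {lam : ℕ → ℝ} (h : totalRate l lam ≠ 0) (m : ℕ) :
    totalRate l lam * groupProb l lam m = lam m := by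
  rw [groupProb, mul_div_cancel₀ _ h]

theorem totalRate_pos {l : ℕ} (hl : 1 ≤ l) {lam : ℕ → ℝ}
    (hlam : ∀ j ∈ Finset.Icc 1 l, 0 < lam j) : 0 < totalRate l lam :=
  Finset.sum_pos hlam ⟨1, by simp [hl]⟩

theorem tendsto_div_of_isLittleO {f : ℝ → ℝ} {a : ℝ}
    (h : (fun u => f u - a * u) =o[𝓝[>] 0] fun u => u) :
    Tendsto (fun u => f u / u) (𝓝[>] 0) (𝓝 a) := by
  have h1 := h.tendsto_div_nhds_zero.add_const a
  rw [zero_add] at h1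
  refine h1.congr' ?_
  filter_upwards [self_mem_nhdsWithin] with u hu
  have : u ≠ 0 := ne_of_gt hu
  field_simp
  ring

section Queue

variable {Ω : Type*} [MeasurableSpace Ω] {P : Measure Ω} {Q : ℝ → Ω → ℕ × ℕ}
  {k l : ℕ} {mu : ℝ} {lam : ℕ → ℝ}

theorem IsErlangQueue.mem_stateSpace_of_ne_zero (hQ : IsErlangQueue P Q k l mu lam) {t : ℝ}
    (ht : 0 ≤ t) {x : ℕ × ℕ} (hx : P {ω | Q t ω = x} ≠ 0) : x ∈ stateSpace k := by
  obtain ⟨ω, hω⟩ := nonempty_of_measure_ne_zero hx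
  exact hω ▸ hQ.mem_stateSpace t ht ω

/-- The infinitesimal description of the queue says that its transition probabilities have the
right derivative `generator` at `0`. -/
theorem IsErlangQueue.tendsto_transProb (hQ : IsErlangQueue P Q k l mu lam)
    (hΛ : totalRate l lam ≠ 0) {t : ℝ} (ht : 0 ≤ t) {x : ℕ × ℕ} (hx : P {ω | Q t ω = x} ≠ 0)
    (y : ℕ × ℕ) :
    Tendsto (fun h => (transProb P Q t h x y - if x = y then 1 else 0) / h) (𝓝[>] 0)
      (𝓝 (generator k l mu lam x y)) := by
  have hS := hQ.mem_stateSpace_of_ne_zero ht hx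
  rcases eq_or_ne x y with rfl | hxy
  · rw [generator_self hS]
    refine tendsto_div_of_isLittleO ?_
    by_cases h0 : x = (0, 0)
    · subst h0
      refine (hQ.stay_empty t ht hx).congr_left fun h => ?_
      simp [exitRate]
      ring
    · -- The product `(1 - Λ h) (1 - k μ h)` contains a term of second order.
      have hsq : (fun h : ℝ => totalRate l lam * (k * mu) * h ^ 2) =o[𝓝[>] 0] fun h => h := by
        refine IsLittleO.const_mul_left ?_ _
        simpa using (isLittleO_pow_id (𝕜 := ℝ) one_lt_two).mono nhdsWithin_le_nhds
      refine ((hQ.stay_busy t ht x h0 hx).add hsq).congr_left fun h => ?_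
      simp [exitRate, h0]
      ring
  · refine tendsto_div_of_isLittleO ?_
    simp only [generator, if_neg hxy, sub_zero]
    by_cases hA : ∃ m ∈ Finset.Icc 1 l, y = afterArrival k m x
    · obtain ⟨m, hm, rfl⟩ := hA
      have hph : ¬ (x ≠ (0, 0) ∧ afterPhase k x = afterArrival k m x) := fun h =>
        absurd (h.2 ▸ fst_afterPhase_le x)
          (not_le.mpr (lt_fst_afterArrival (Finset.mem_Icc.mp hm).1 x))
      rw [Finset.sum_eq_single_of_mem m hm fun m' _ hne =>
        if_neg fun h => hne (afterArrival_injective h), if_pos rfl, if_neg hph, add_zero,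
        ← totalRate_mul_groupProb hΛ m]
      exact hQ.arrival t ht x hx m hm
    · push Not at hA
      rw [Finset.sum_eq_zero fun m hm => if_neg (hA m hm).symm, zero_add]
      by_cases hph : x ≠ (0, 0) ∧ afterPhase k x = y
      · obtain ⟨h0, rfl⟩ := hph
        simpa [h0] using hQ.phase t ht x h0 hx
      · rw [if_neg hph]
        simpa using hQ.other t ht x y hx hxy.symm hA fun h0 h => hph ⟨h0, h.symm⟩

theorem IsErlangQueue.measurableSet_eq (hQ : IsErlangQueue P Q k l mu lam) {t : ℝ}
    (ht : 0 ≤ t) (x : ℕ × ℕ) : MeasurableSet {ω | Q t ω = x} :=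
  hQ.measurable t ht (measurableSet_singleton x)

theorem transProb_nonneg (t h : ℝ) (x y : ℕ × ℕ) : 0 ≤ transProb P Q t h x y :=
  measureReal_nonneg

theorem transProb_le_one (t h : ℝ) (x y : ℕ × ℕ) : transProb P Q t h x y ≤ 1 :=
  measureReal_le_one

variable [IsProbabilityMeasure P]

/-- Supermultiplicativity of the probability of being again in `x`, obtained by restricting to the
paths that are in `x` also at the intermediate time `t + s`. -/
theorem IsErlangQueue.transProb_self_mul_le (hQ : IsErlangQueue P Q k l mu lam) {t : ℝ}
    (ht : 0 ≤ t) {x : ℕ × ℕ} (hx : P {ω | Q t ω = x} ≠ 0) {s h : ℝ} (hs : 0 ≤ s) (hh : 0 ≤ h) :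
    transProb P Q t s x x * transProb P Q t h x x ≤ transProb P Q t (s + h) x x := by
  have hA := hQ.measurableSet_eq ht x
  have hB := hQ.measurableSet_eq (add_nonneg ht hs) x
  have hpos : 0 < P.real {ω | Q t ω = x} := by
    rw [measureReal_def]
    exact ENNReal.toReal_pos hx (measure_ne_top _ _)
  have hmul := cond_real_mul P hA {ω | Q (t + s) ω = x}
  by_cases h0 : P ({ω | Q t ω = x} ∩ {ω | Q (t + s) ω = x}) = 0
  · rw [measureReal_def P (_ ∩ _), h0, ENNReal.toReal_zero, mul_eq_zero,
      or_iff_left hpos.ne'] at hmul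
    rw [transProb, hmul, zero_mul]
    exact transProb_nonneg _ _ _ _
  · have hx' : P {ω | Q (t + s) ω = x} ≠ 0 :=
      fun h => h0 (measure_mono_null Set.inter_subset_right h)
    have hF : MeasurableSet[history Q (t + s)] {ω | Q t ω = x} := by
      have hle : MeasurableSpace.comap (Q t) inferInstance ≤ history Q (t + s) :=
        le_iSup₂_of_le (f := fun u (_ : u ∈ Set.Icc (0 : ℝ) (t + s)) =>
          MeasurableSpace.comap (Q u) inferInstance) t ⟨ht, by linarith⟩ le_rfl
      exact hle _ ⟨{x}, measurableSet_singleton x, rfl⟩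
    -- Markov property at time `t + s`, the past being the event `Q t = x`.
    have hM := hQ.markov (t + s) h (add_nonneg ht hs) hh x x _ hF h0
    rw [hQ.homogeneous (t + s) t h (add_nonneg ht hs) ht hh x x hx' hx] at hM
    have hmul' := cond_real_mul P (hA.inter hB) {ω | Q (t + s + h) ω = x}
    rw [hM] at hmul'
    have hmul'' := cond_real_mul P hA {ω | Q (t + (s + h)) ω = x}
    have hle : P.real ({ω | Q t ω = x} ∩ {ω | Q (t + s) ω = x} ∩ {ω | Q (t + s + h) ω = x})
        ≤ P.real ({ω | Q t ω = x} ∩ {ω | Q (t + (s + h)) ω = x}) := by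
      refine measureReal_mono ?_
      rw [add_assoc]
      exact Set.inter_subset_inter_left _ Set.inter_subset_left
    refine le_of_mul_le_mul_right ?_ hpos
    calc transProb P Q t s x x * transProb P Q t h x x * P.real {ω | Q t ω = x}
        = transProb P Q t h x x * (transProb P Q t s x x * P.real {ω | Q t ω = x}) := by ring
      _ = _ := by rw [transProb.eq_1 P Q t s, hmul, hmul']
      _ ≤ _ := hle
      _ = _ := hmul''.symm

/-- The bound on the probability of leaving a state that holds uniformly over all states. -/
theorem IsErlangQueue.one_sub_transProb_self_le (hQ : IsErlangQueue P Q k l mu lam)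
    (hΛ : totalRate l lam ≠ 0) (hmu : 0 ≤ mu) {t : ℝ} (ht : 0 ≤ t) {x : ℕ × ℕ}
    (hx : P {ω | Q t ω = x} ≠ 0) {h : ℝ} (hh : 0 ≤ h) :
    1 - transProb P Q t h x x ≤ (totalRate l lam + k * mu) * h := by
  have hS := hQ.mem_stateSpace_of_ne_zero ht hx
  have hlim := hQ.tendsto_transProb hΛ ht hx x
  simp only [if_true, generator_self hS] at hlim
  have hzero : transProb P Q t 0 x x = 1 := by
    have := cond_isProbabilityMeasure hx
    have hu := cond_real_congr P (hQ.measurableSet_eq ht x)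
      (B := {ω | Q (t + 0) ω = x}) (C := Set.univ) (by simp)
    rw [transProb, hu, probReal_univ]
  refine (one_sub_le_mul_of_supermul (f := fun u => transProb P Q t u x x)
    (fun _ _ => transProb_nonneg _ _ _ _) hzero
    (fun s u hs hu => hQ.transProb_self_mul_le ht hx hs hu) hlim hh).trans ?_
  gcongr
  rw [exitRate]
  gcongr
  split_ifs
  · positivity
  · rfl

/-! ### The forward equation -/

theorem IsErlangQueue.measureReal_ne_le (hQ : IsErlangQueue P Q k l mu lam)
    (hΛ : totalRate l lam ≠ 0) (hmu : 0 ≤ mu) {t h : ℝ} (ht : 0 ≤ t) (hh : 0 ≤ h) :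
    P.real {ω | Q (t + h) ω ≠ Q t ω} ≤ (totalRate l lam + k * mu) * h := by
  have hmt := hQ.measurable t ht
  rw [← integral_cond_fiber P hmt]
  have hle : ∀ᵐ ω ∂P, (cond P {ω' | Q t ω' = Q t ω}).real {ω | Q (t + h) ω ≠ Q t ω}
      ≤ (totalRate l lam + k * mu) * h := by
    filter_upwards [ae_fiber_ne_zero P (Q t)] with ω hω
    have hA := hQ.measurableSet_eq ht (Q t ω)
    have := cond_isProbabilityMeasure hω
    have hB' := hQ.measurableSet_eq (add_nonneg ht hh) (Q t ω)
    rw [cond_real_congr P (C := {ω' | Q (t + h) ω' = Q t ω}ᶜ) hA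
        (by ext ω'; simp +contextual), probReal_compl_eq_one_sub hB']
    exact hQ.one_sub_transProb_self_le hΛ hmu ht hω hh
  calc _ ≤ ∫ _, (totalRate l lam + k * mu) * h ∂P :=
        integral_mono_of_nonneg (.of_forall fun _ => measureReal_nonneg) (integrable_const _) hle
    _ = _ := by simp

/-- Since the process rarely moves in a short time, the probability of each set of states is
Lipschitz in time. -/
theorem IsErlangQueue.continuousOn_measureReal (hQ : IsErlangQueue P Q k l mu lam)
    (hΛ : totalRate l lam ≠ 0) (hmu : 0 ≤ mu) (A : Set (ℕ × ℕ)) :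
    ContinuousOn (fun t => P.real {ω | Q t ω ∈ A}) (Set.Ici 0) := by
  have key : ∀ t h, 0 ≤ t → 0 ≤ h →
      |P.real {ω | Q (t + h) ω ∈ A} - P.real {ω | Q t ω ∈ A}|
        ≤ (totalRate l lam + k * mu) * h := by
    intro t h ht hh
    have hmeas : ∀ u, 0 ≤ u → MeasurableSet {ω | Q u ω ∈ A} :=
      fun u hu => hQ.measurable u hu A.to_countable.measurableSet
    refine (abs_measureReal_sub_le_measureReal_symmDiff'
      (hmeas _ (add_nonneg ht hh)).nullMeasurableSet (hmeas t ht).nullMeasurableSet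
      (measure_ne_top _ _) (measure_ne_top _ _)).trans
      ((measureReal_mono ?_).trans (hQ.measureReal_ne_le hΛ hmu ht hh))
    rintro ω hω (heq : Q (t + h) ω = Q t ω)
    simp [Set.mem_symmDiff, heq] at hω
  refine (LipschitzOnWith.of_dist_le' (K := totalRate l lam + k * mu) ?_).continuousOn
  intro s hs t ht
  rw [Real.dist_eq, Real.dist_eq]
  rcases le_total s t with h | h
  · have := key s (t - s) hs (by linarith)
    rwa [add_sub_cancel, abs_sub_comm, ← abs_of_nonneg (sub_nonneg.mpr h), abs_sub_comm t] at this
  · have := key t (s - t) ht (by linarith)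
    rwa [add_sub_cancel, ← abs_of_nonneg (sub_nonneg.mpr h)] at this

/-- The forward equation, as a right derivative. The difference quotients are expectations of
functions of the present state that converge pointwise and are bounded by the uniform bound on the
exit probabilities, so the limit may be taken under the expectation. -/
theorem IsErlangQueue.hasDerivWithinAt_Ioi (hQ : IsErlangQueue P Q k l mu lam)
    (hΛ : totalRate l lam ≠ 0) (hmu : 0 ≤ mu) {t : ℝ} (ht : 0 ≤ t) (y : ℕ × ℕ) :
    HasDerivWithinAt (fun u => P.real {ω | Q u ω = y})
      (∫ ω, generator k l mu lam (Q t ω) y ∂P) (Set.Ioi t) t := by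
  have hmt := hQ.measurable t ht
  have hI : ∀ F : ℕ × ℕ → ℝ, AEStronglyMeasurable (fun ω => F (Q t ω)) P := fun F =>
    ((measurable_of_countable F).comp hmt).aestronglyMeasurable
  rw [hasDerivWithinAt_iff_tendsto_slope' Set.self_notMem_Ioi]
  have hlim : Tendsto
      (fun h => ∫ ω, (transProb P Q t h (Q t ω) y - if Q t ω = y then 1 else 0) / h ∂P)
      (𝓝[>] 0) (𝓝 (∫ ω, generator k l mu lam (Q t ω) y ∂P)) := by
    refine tendsto_integral_filter_of_dominated_convergence
      (fun _ => totalRate l lam + k * mu) (.of_forall fun h =>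
        hI fun x => (transProb P Q t h x y - if x = y then 1 else 0) / h) ?_
      (integrable_const _) ?_
    · filter_upwards [self_mem_nhdsWithin] with h hh
      have hh' : (0 : ℝ) < h := hh
      filter_upwards [ae_fiber_ne_zero P (Q t)] with ω hω
      have hstay := hQ.one_sub_transProb_self_le hΛ hmu ht hω hh'.le
      rw [Real.norm_eq_abs, abs_div, abs_of_pos hh', div_le_iff₀ hh']
      split_ifs with hy
      · subst hy
        rw [abs_sub_comm, abs_of_nonneg (sub_nonneg.mpr (transProb_le_one _ _ _ _))]
        exact hstay
      · rw [sub_zero, abs_of_nonneg (transProb_nonneg _ _ _ _)]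
        -- As `y` is not the present state, reaching `y` means leaving the present state.
        have hB := hQ.measurableSet_eq (add_nonneg ht hh'.le) (Q t ω)
        have := cond_isProbabilityMeasure hω
        refine le_trans ?_ hstay
        rw [transProb, transProb, ← probReal_compl_eq_one_sub hB]
        exact measureReal_mono fun ω' h1 h2 => hy (h2.symm.trans h1)
    · filter_upwards [ae_fiber_ne_zero P (Q t)] with ω hω
      exact hQ.tendsto_transProb hΛ ht hω y
  have hshift : Tendsto (fun u : ℝ => u - t) (𝓝[>] t) (𝓝[>] 0) := by
    refine tendsto_nhdsWithin_iff.mpr ⟨?_, ?_⟩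
    · have h : Continuous fun u : ℝ => u - t := by fun_prop
      exact (h.tendsto' t 0 (sub_self t)).mono_left nhdsWithin_le_nhds
    · filter_upwards [self_mem_nhdsWithin] with u hu
      exact Set.mem_Ioi.mpr (sub_pos.mpr (Set.mem_Ioi.mp hu))
  refine (hlim.comp hshift).congr' ?_
  filter_upwards [self_mem_nhdsWithin] with u hu
  have hu' : t < u := hu
  have htr := integral_cond_fiber P hmt {ω | Q u ω = y}
  have hu2 : t + (u - t) = u := by ring
  rw [Function.comp_apply, integral_div, integral_sub, slope_def_field]
  · congr 2
    · simp only [transProb, hu2]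
      exact htr
    · have := integral_indicator_const (μ := P) (1 : ℝ) (hQ.measurableSet_eq ht y)
      rw [smul_eq_mul, mul_one] at this
      rw [← this]
      simp [Set.indicator_apply]
  · refine .of_bound (hI fun x => transProb P Q t (u - t) x y) 1 (.of_forall fun ω => ?_)
    rw [Real.norm_of_nonneg (transProb_nonneg _ _ _ _)]
    exact transProb_le_one _ _ _ _
  · refine .of_bound (hI fun x => if x = y then 1 else 0) 1 (.of_forall fun ω => ?_)
    split_ifs <;> simp

/-- The expected rate of flow into `y` splits according to the type of event. -/
theorem IsErlangQueue.integral_generator (hQ : IsErlangQueue P Q k l mu lam) {t : ℝ}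
    (ht : 0 ≤ t) (y : ℕ × ℕ) :
    ∫ ω, generator k l mu lam (Q t ω) y ∂P
      = (∑ m ∈ Finset.Icc 1 l, lam m * P.real {ω | afterArrival k m (Q t ω) = y})
        + k * mu * P.real {ω | Q t ω ≠ (0, 0) ∧ afterPhase k (Q t ω) = y}
        - exitRate k l mu lam y * P.real {ω | Q t ω = y} := by
  have hmeas : ∀ A : Set (ℕ × ℕ), MeasurableSet {ω | Q t ω ∈ A} :=
    fun A => hQ.measurable t ht A.to_countable.measurableSet
  have hint : ∀ (A : Set (ℕ × ℕ)) [DecidablePred (· ∈ A)] (a : ℝ),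
      Integrable (fun ω => if Q t ω ∈ A then a else 0) P ∧
        ∫ ω, (if Q t ω ∈ A then a else 0) ∂P = a * P.real {ω | Q t ω ∈ A} := by
    intro A _ a
    have he : (fun ω => if Q t ω ∈ A then a else 0) = {ω | Q t ω ∈ A}.indicator fun _ => a := by
      ext ω
      simp [Set.indicator_apply]
    rw [he, integral_indicator_const a (hmeas A), smul_eq_mul, mul_comm]
    exact ⟨(integrable_const a).indicator (hmeas A), rfl⟩
  have harr := fun m => hint {x | afterArrival k m x = y} (lam m)
  have hph := hint {x | x ≠ (0, 0) ∧ afterPhase k x = y} (k * mu)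
  have hex := hint {x | x = y} (exitRate k l mu lam y)
  simp only [Set.mem_ofPred_eq] at harr hph hex
  have hsum := integrable_finsetSum (Finset.Icc 1 l) fun m _ => (harr m).1
  simp only [generator]
  rw [integral_sub (hsum.fun_add hph.1) hex.1, integral_add hsum hph.1,
    integral_finsetSum _ fun m _ => (harr m).1, hph.2, hex.2]
  simp only [fun m => (harr m).2]

/-- Kolmogorov's forward equation for the queue. -/
theorem IsErlangQueue.forward_equation (hQ : IsErlangQueue P Q k l mu lam)
    (hΛ : totalRate l lam ≠ 0) (hmu : 0 ≤ mu) {t : ℝ} (ht : 0 ≤ t) (y : ℕ × ℕ) :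
    HasDerivWithinAt (fun u => P.real {ω | Q u ω = y})
      ((∑ m ∈ Finset.Icc 1 l, lam m * P.real {ω | afterArrival k m (Q t ω) = y})
        + k * mu * P.real {ω | Q t ω ≠ (0, 0) ∧ afterPhase k (Q t ω) = y}
        - exitRate k l mu lam y * P.real {ω | Q t ω = y}) (Set.Ici 0) t := by
  have hc := hQ.continuousOn_measureReal hΛ hmu
  have hg : ContinuousOn (fun u =>
      (∑ m ∈ Finset.Icc 1 l, lam m * P.real {ω | afterArrival k m (Q u ω) = y})
        + k * mu * P.real {ω | Q u ω ≠ (0, 0) ∧ afterPhase k (Q u ω) = y}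
        - exitRate k l mu lam y * P.real {ω | Q u ω = y}) (Set.Ici 0) :=
    ((continuousOn_finsetSum _ fun m _ =>
      continuousOn_const.mul (hc {x | afterArrival k m x = y})).add
      (continuousOn_const.mul (hc {x | x ≠ (0, 0) ∧ afterPhase k x = y}))).sub
      (continuousOn_const.mul (hc {y}))
  refine hasDerivWithinAt_of_right (hc {y}) hg (fun u hu => ?_) ht
  rw [← hQ.integral_generator hu y]
  exact hQ.hasDerivWithinAt_Ioi hΛ hmu hu y

end Queue

/-! ### Predecessors of a state -/

theorem afterPhase_eq_empty_iff {k : ℕ} (hk : 1 ≤ k) {x : ℕ × ℕ} (hx : x ∈ stateSpace k) :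
    x ≠ (0, 0) ∧ afterPhase k x = (0, 0) ↔ x = (1, 1) := by
  obtain ⟨n, s⟩ := x
  simp only [stateSpace, Set.mem_ofPred_eq, afterPhase, ne_eq, Prod.mk.injEq] at *
  split_ifs <;> simp only [Prod.mk.injEq, and_true] <;> omega

theorem afterPhase_eq_iff_of_lt {k n s : ℕ} (hn : 1 ≤ n) (hs : 1 ≤ s) (hsk : s < k)
    {x : ℕ × ℕ} (hx : x ∈ stateSpace k) :
    x ≠ (0, 0) ∧ afterPhase k x = (n, s) ↔ x = (n, s + 1) := by
  obtain ⟨n', s'⟩ := x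
  simp only [stateSpace, Set.mem_ofPred_eq, afterPhase, ne_eq, Prod.mk.injEq] at *
  split_ifs <;> simp only [Prod.mk.injEq] <;> omega

theorem afterPhase_eq_last_iff {k n : ℕ} (hk : 1 ≤ k) (hn : 1 ≤ n)
    {x : ℕ × ℕ} (hx : x ∈ stateSpace k) :
    x ≠ (0, 0) ∧ afterPhase k x = (n, k) ↔ x = (n + 1, 1) := by
  obtain ⟨n', s'⟩ := x
  simp only [stateSpace, Set.mem_ofPred_eq, afterPhase, ne_eq, Prod.mk.injEq] at *
  split_ifs <;> simp only [Prod.mk.injEq, and_true] <;> omega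

theorem afterArrival_eq_iff {k m n s : ℕ} (hs : 1 ≤ s)
    {x : ℕ × ℕ} (hx : x ∈ stateSpace k) :
    afterArrival k m x = (n, s) ↔
      m < n ∧ x = (n - m, s) ∨ (m = n ∧ s = k) ∧ x = (0, 0) := by
  obtain ⟨n', s'⟩ := x
  simp only [stateSpace, Set.mem_ofPred_eq, afterArrival, Prod.mk.injEq] at *
  split_ifs <;> simp only [Prod.mk.injEq] <;> omega

section Queue

variable {Ω : Type*} [MeasurableSpace Ω] {P : Measure Ω} [IsProbabilityMeasure P]
  {Q : ℝ → Ω → ℕ × ℕ} {k l : ℕ} {mu : ℝ} {lam : ℕ → ℝ}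

theorem IsErlangQueue.prob_eq (hQ : IsErlangQueue P Q k l mu lam) (n s : ℕ) (t : ℝ) :
    prob P Q n s t = P.real {ω | Q t ω = (n, s)} := by
  have h1 : P {ω | Q 0 ω = (0, 0)} = 1 :=
    (mem_ae_iff_prob_eq_one (hQ.measurableSet_eq le_rfl _)).mp hQ.start
  rw [prob, ProbabilityTheory.cond, h1, inv_one, one_smul,
    Measure.restrict_eq_self_of_ae_mem (s := {ω | Q 0 ω = (0, 0)}) hQ.start]

theorem IsErlangQueue.prob_eq_zero (hQ : IsErlangQueue P Q k l mu lam) {s : ℕ} (hs : 1 ≤ s)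
    {t : ℝ} (ht : 0 ≤ t) : prob P Q 0 s t = 0 := by
  have : {ω | Q t ω = (0, s)} = ∅ := by
    ext ω
    have := hQ.mem_stateSpace t ht ω
    simp only [stateSpace, Set.mem_ofPred_eq, Set.mem_empty_iff_false, iff_false] at *
    rintro h
    simp [h] at this
    omega
  rw [hQ.prob_eq, this, measureReal_empty]

theorem IsErlangQueue.measureReal_afterArrival (hQ : IsErlangQueue P Q k l mu lam) {t : ℝ}
    (ht : 0 ≤ t) {m n s : ℕ} (hs : 1 ≤ s) :
    P.real {ω | afterArrival k m (Q t ω) = (n, s)} =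
      if m < n then prob P Q (n - m) s t else if m = n ∧ s = k then prob P Q 0 0 t else 0 := by
  have h : {ω | afterArrival k m (Q t ω) = (n, s)} = {ω | m < n ∧ Q t ω = (n - m, s) ∨
      (m = n ∧ s = k) ∧ Q t ω = (0, 0)} :=
    Set.ext fun ω => afterArrival_eq_iff hs (hQ.mem_stateSpace t ht ω)
  rw [h, hQ.prob_eq, hQ.prob_eq]
  split_ifs with h1 h2
  · simp [h1, h1.ne]
  · simp [h2]
  · simp [h1, h2]

/-- The forward equation in the empty state. -/
theorem IsErlangQueue.hasDerivWithinAt_prob_empty (hQ : IsErlangQueue P Q k l mu lam)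
    (hk : 1 ≤ k) (hΛ : totalRate l lam ≠ 0) (hmu : 0 ≤ mu) {t : ℝ} (ht : 0 ≤ t) :
    HasDerivWithinAt (prob P Q 0 0)
      (-totalRate l lam * prob P Q 0 0 t + k * mu * prob P Q 1 1 t) (Set.Ici 0) t := by
  have hfun : prob P Q 0 0 = fun u => P.real {ω | Q u ω = (0, 0)} := funext (hQ.prob_eq 0 0)
  rw [hQ.prob_eq 0 0, hQ.prob_eq 1 1, hfun]
  convert hQ.forward_equation hΛ hmu ht (0, 0) using 1
  have hph : {ω | Q t ω ≠ (0, 0) ∧ afterPhase k (Q t ω) = (0, 0)} = {ω | Q t ω = (1, 1)} :=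
    Set.ext fun ω => afterPhase_eq_empty_iff hk (hQ.mem_stateSpace t ht ω)
  rw [hph, Finset.sum_eq_zero]
  · simp only [exitRate, if_true]
    ring
  · intro m hm
    have : {ω | afterArrival k m (Q t ω) = (0, 0)} = ∅ := by
      refine Set.eq_empty_of_forall_notMem fun ω h => ?_
      have hlt := lt_fst_afterArrival (k := k) (Finset.mem_Icc.mp hm).1 (Q t ω)
      rw [Set.mem_ofPred_eq.mp h] at hlt
      exact Nat.not_lt_zero _ hlt
    rw [this, measureReal_empty, mul_zero]

/-- The forward equation in a busy state `(n, s)`, where `z` is the state that is left for `(n, s)`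
at the end of a phase. -/
theorem IsErlangQueue.hasDerivWithinAt_prob_busy (hQ : IsErlangQueue P Q k l mu lam)
    (hΛ : totalRate l lam ≠ 0) (hmu : 0 ≤ mu) {t : ℝ} (ht : 0 ≤ t) {n s : ℕ} (hn : 1 ≤ n)
    (hs : 1 ≤ s) {z : ℕ × ℕ}
    (hz : ∀ x ∈ stateSpace k, x ≠ (0, 0) ∧ afterPhase k x = (n, s) ↔ x = z) :
    HasDerivWithinAt (prob P Q n s)
      (-(totalRate l lam + k * mu) * prob P Q n s t + k * mu * prob P Q z.1 z.2 t
        + ∑ m ∈ Finset.Icc 1 l, lam m * if m < n then prob P Q (n - m) s t else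
            if m = n ∧ s = k then prob P Q 0 0 t else 0) (Set.Ici 0) t := by
  have hfun : prob P Q n s = fun u => P.real {ω | Q u ω = (n, s)} := funext (hQ.prob_eq n s)
  rw [Finset.sum_congr rfl fun m _ => congrArg (lam m * ·)
    (hQ.measureReal_afterArrival ht (n := n) hs).symm,
    hQ.prob_eq n s, hQ.prob_eq z.1 z.2, hfun]
  convert hQ.forward_equation hΛ hmu ht (n, s) using 1
  have hph : {ω | Q t ω ≠ (0, 0) ∧ afterPhase k (Q t ω) = (n, s)} = {ω | Q t ω = z} :=
    Set.ext fun ω => hz _ (hQ.mem_stateSpace t ht ω)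
  have hne : ((n, s) : ℕ × ℕ) ≠ (0, 0) := by
    rw [ne_eq, Prod.mk.injEq]
    omega
  rw [hph, exitRate, if_neg hne]
  ring

end Queue

end ErlangQueue

theorem theoremt3p1 {Ω : Type*} [MeasurableSpace Ω] (P : Measure Ω) [IsProbabilityMeasure P]
    (Q : ℝ → Ω → ℕ × ℕ) (k l : ℕ) (hk : 1 ≤ k) (hl : 1 ≤ l)
    (mu : ℝ) (hmu : 0 < mu) (lam : ℕ → ℝ) (hlam : ∀ j ∈ Finset.Icc 1 l, 0 < lam j)
    (hQ : ErlangQueue.IsErlangQueue P Q k l mu lam)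
    (Λ : ℝ) (hΛ : Λ = ErlangQueue.totalRate l lam)
    (c : ℕ → ℝ) (hc : c = ErlangQueue.groupProb l lam)
    (p₀ : ℝ → ℝ) (hp₀ : p₀ = ErlangQueue.prob P Q 0 0)
    (p : ℕ → ℕ → ℝ → ℝ) (hp : p = ErlangQueue.prob P Q) :
    (∀ t : ℝ, 0 ≤ t →
      HasDerivWithinAt p₀ (-Λ * p₀ t + k * mu * p 1 1 t) (Set.Ici 0) t ∧
      (∀ s, 1 ≤ s → s + 1 ≤ k →
        HasDerivWithinAt (p 1 s)
          (-(Λ + k * mu) * p 1 s t + k * mu * p 1 (s + 1) t) (Set.Ici 0) t) ∧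
      HasDerivWithinAt (p 1 k)
        (-(Λ + k * mu) * p 1 k t + k * mu * p 2 1 t + Λ * c 1 * p₀ t) (Set.Ici 0) t ∧
      (∀ n s, 2 ≤ n → 1 ≤ s → s + 1 ≤ k →
        HasDerivWithinAt (p n s)
          (-(Λ + k * mu) * p n s t + k * mu * p n (s + 1) t
            + Λ * ∑ m ∈ Finset.Icc 1 (min n l), c m * p (n - m) s t) (Set.Ici 0) t) ∧
      (∀ n, 2 ≤ n → n ≤ l →
        HasDerivWithinAt (p n k)
          (-(Λ + k * mu) * p n k t + k * mu * p (n + 1) 1 t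
            + Λ * ∑ m ∈ Finset.Icc 1 (n - 1), c m * p (n - m) k t + Λ * c n * p₀ t)
          (Set.Ici 0) t) ∧
      (∀ n, l < n →
        HasDerivWithinAt (p n k)
          (-(Λ + k * mu) * p n k t + k * mu * p (n + 1) 1 t
            + Λ * ∑ m ∈ Finset.Icc 1 l, c m * p (n - m) k t) (Set.Ici 0) t)) ∧
    p₀ 0 = 1 ∧
    (∀ n s, 1 ≤ n → 1 ≤ s → s ≤ k → p n s 0 = 0) := by
  have hΛ0 : ErlangQueue.totalRate l lam ≠ 0 := (ErlangQueue.totalRate_pos hl hlam).ne'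
  have hlamc : ∀ m, Λ * c m = lam m := fun m => by
    rw [hΛ, hc, ErlangQueue.totalRate_mul_groupProb hΛ0]
  refine ⟨fun t ht => ?_, ?_, ?_⟩
  · have hphase := fun n s (hn : 1 ≤ n) (hs : 1 ≤ s) (hsk : s + 1 ≤ k) =>
      hQ.hasDerivWithinAt_prob_busy hΛ0 hmu.le ht hn hs (z := (n, s + 1))
        fun x hx => ErlangQueue.afterPhase_eq_iff_of_lt hn hs hsk hx
    have hlast := fun n (hn : 1 ≤ n) =>
      hQ.hasDerivWithinAt_prob_busy hΛ0 hmu.le ht hn hk (z := (n + 1, 1))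
        fun x hx => ErlangQueue.afterPhase_eq_last_iff hk hn hx
    have hempty := hQ.hasDerivWithinAt_prob_empty hk hΛ0 hmu.le ht
    have hzero := fun s (hs : 1 ≤ s) => hQ.prob_eq_zero hs ht
    simp only [← hΛ, ← hp, ← hp₀] at hphase hlast hempty hzero
    simp only [Finset.mul_sum, ← mul_assoc, hlamc]
    refine ⟨hempty, fun s hs hsk => ?_, ?_, fun n s hn hs hsk => ?_, fun n hn hnl => ?_,
      fun n hn => ?_⟩
    · convert hphase 1 s le_rfl hs hsk using 1
      rw [Finset.sum_eq_zero, add_zero]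
      intro m hm
      have := (Finset.mem_Icc.mp hm).1
      rw [if_neg (by omega), if_neg (by omega), mul_zero]
    · convert hlast 1 le_rfl using 1
      rw [Finset.sum_eq_single_of_mem 1 (by simp [hl])]
      · simp
      · intro m hm hne
        have := (Finset.mem_Icc.mp hm).1
        rw [if_neg (by omega), if_neg (by omega), mul_zero]
    · convert hphase n s (by omega) hs hsk using 2
      -- The sums run over `m ≤ min n l` and `m ≤ l`; the term `m = n` of the former is a multiple
      -- of `p 0 s`, which vanishes.
      refine Finset.sum_congr_of_eq_on_inter ?_ ?_ ?_ <;> intro m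
      · simp only [Finset.mem_Icc]
        omega
      · simp only [Finset.mem_Icc]
        intro h1 h2
        rw [if_neg (by omega), if_neg (by omega), mul_zero]
      · simp only [Finset.mem_Icc]
        intro h1 h2
        split_ifs with h3 h4
        · rfl
        · omega
        · rw [show n - m = 0 by omega, hzero s hs]
    · convert hlast n (by omega) using 1
      rw [add_assoc]
      congr 1
      rw [← Finset.sum_subset (Finset.Icc_subset_Icc_right hnl),
        ← Finset.insert_Icc_sub_one_right_eq_Icc (by omega : 1 ≤ n),
        Finset.sum_insert (by simp; omega), add_comm, if_neg (lt_irrefl n), if_pos (by simp)]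
      · congr 1
        refine Finset.sum_congr rfl fun m hm => ?_
        rw [if_pos (by have := Finset.mem_Icc.mp hm; omega)]
      · intro m hm hm'
        simp only [Finset.mem_Icc] at hm hm'
        rw [if_neg (by omega), if_neg (by omega), mul_zero]
    · convert hlast n (by omega) using 2
      refine Finset.sum_congr rfl fun m hm => ?_
      rw [if_pos ((Finset.mem_Icc.mp hm).2.trans_lt hn)]
  · rw [hp₀, hQ.prob_eq, measureReal_def,
      (mem_ae_iff_prob_eq_one (hQ.measurableSet_eq le_rfl _)).mp hQ.start, ENNReal.toReal_one]
  · intro n s hn hs hsk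
    rw [hp, hQ.prob_eq, measureReal_eq_zero_iff, measure_eq_zero_iff_ae_notMem]
    filter_upwards [hQ.start] with ω hω h
    rw [Set.mem_ofPred_eq.mp h] at hω
    simp at hω
    omega
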